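/- Let $\mathsf H$ be a real, complex or quaternionic Hilbert space, not necessarily separable, with scalars $\mathbb D=\mathbb R,\mathbb C$ or $\mathbb H$. For $\mathbb D=\mathbb H$ this means: $\mathsf H$ is a right $\mathbb H$-module with a positive definite Hermitian $\mathbb H$-valued scalar product $\langle\cdot|\cdot\rangle$ which is $\mathbb H$-linear in the right entry, and $\mathsf H$ is complete for the norm $\|x\|=\sqrt{\langle x|x\rangle}$. Let $\mathfrak B(\mathsf H)$ be the set of bounded $\mathbb D$-linear operators on $\mathsf H$. An operator $T\in\mathfrak B(\mathsf H)$ is positive, $T\ge 0$, if $\langle u|Tu\rangle\ge 0$ for all $u\in\mathsf H$; its absolute value $|T|=\sqrt{T^*T}$ is the self-adjoint positive operator with $|T|\,|T|=T^*T$. A Hilbert basis is an orthonormal set with dense linear span. $T$ is of trace class, $T\in\mathfrak B_1(\mathsf H)$, if $\sum_{u\in N}\langle u|\,|T|u\rangle<+\infty$ for some Hilbert basis $N$; its real trace is $$tr^{\mathbb R}(T)=\mathrm{Re}\Big(\sum_{u\in N}\langle u|Tu\rangle\Big)$$ for a Hilbert basis $N$. Let $A\in\mathfrak B(\mathsf H)$,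 let $B=B^*\in\mathfrak B_1(\mathsf H)$ with $B\ge 0$, let $G$ be a topological group and let $G\ni g\mapsto U_g$ be a strongly continuous unitary representation of $G$ on $\mathsf H$: a homomorphism into the group of norm-preserving surjective $\mathbb D$-linear operators such that $g\mapsto U_gx$ is continuous for every $x\in\mathsf H$. Then for each $g\in G$ the operator $A\,U_gBU_g^{-1}$ is of trace class, its real trace is well defined (for every Hilbert basis $N$ the series $\sum_{u\in N}\langle u|A\,U_gBU_g^{-1}u\rangle$ converges unconditionally, and its real part does not depend on $N$), and the map $$G\ni g\mapsto tr^{\mathbb R}(A\,U_gBU_g^{-1})\in\mathbb R$$ is continuous. In particular, this holds if $A=P$ is an orthogonal projector ($PP=P=P^*$) and $B=T$ is a self-adjoint positive trace-class operator with unit trace ($\sum_{u\in N}\langle u|Tu\rangle=1$ for every Hilbert basis $N$). -/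

import Mathlib

open scoped Quaternion

/-- A quaternionic inner product space: a right `ℍ`-module `H` (scalars act through `ℍᵐᵒᵖ`, so that
`MulOpposite.op q • x` is `x q`) with an `ℍ`-valued scalar product that is `ℍ`-linear in the right
entry, Hermitian and positive, and whose norm is `‖x‖ = √⟨x|x⟩`. It is a quaternionic Hilbert space
if, moreover, `CompleteSpace H`. -/
class QuaternionicInnerProductSpace (H : Type*) [NormedAddCommGroup H] [Module ℍᵐᵒᵖ H]
    extends Inner ℍ H where
  inner_add_right : ∀ x y z : H, inner x (y + z) = inner x y + inner x z
  inner_smul_right : ∀ (x y : H) (q : ℍ), inner x (MulOpposite.op q • y) = inner x y * q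
  star_inner : ∀ x y : H, star (inner x y) = inner y x
  inner_self : ∀ x : H, inner x x = ((‖x‖ ^ 2 : ℝ) : ℍ)

/-- The real part of a scalar, for the scalars `ℝ`, `ℂ` (`RCLike`) and `ℍ`. -/
class RealPart (D : Type*) where
  re : D → ℝ

instance instRealPartRCLike {𝕜 : Type*} [RCLike 𝕜] : RealPart 𝕜 := ⟨fun z => RCLike.re z⟩

noncomputable instance instRealPartQuaternion : RealPart ℍ := ⟨fun q => q.re⟩

/-! The notions below are common to real, complex and quaternionic Hilbert spaces. `D` is where the
scalar product takes its values and `R` is the ring acting on `H`: `R = D = 𝕜` in the real and the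
complex case, and `D = ℍ`, `R = ℍᵐᵒᵖ` (right multiplication) in the quaternionic case. The bounded
operators are the continuous linear maps `H →L[R] H`. -/

section Operators

variable {R : Type*} (D : Type*) {H : Type*} [Ring R] [NormedRing D] [NormedAlgebra ℝ D]
  [NormedAddCommGroup H] [Module R H] [Inner D H]

/-- `N` is a Hilbert basis of `H`: an orthonormal set with dense linear span. -/
structure IsHilbertBasisSet (R : Type*) (D : Type*) {H : Type*} [Ring R] [NormedRing D]
    [NormedAddCommGroup H] [Module R H] [Inner D H] (N : Set H) : Prop where
  inner_self_eq_one : ∀ u ∈ N, inner D u u = 1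
  inner_eq_zero : ∀ u ∈ N, ∀ v ∈ N, u ≠ v → inner D u v = 0
  dense_span : Dense (Submodule.span R N : Set H)

/-- `S = T*`. -/
def IsAdjointOperator (S T : H →L[R] H) : Prop :=
  ∀ x y : H, inner D (S x) y = inner D x (T y)

/-- `T = T*`. -/
def IsSelfAdjointOperator (T : H →L[R] H) : Prop :=
  IsAdjointOperator D T T

/-- `T ≥ 0`: every `⟨u|Tu⟩` is a non-negative real number. -/
def IsPositiveOperator (T : H →L[R] H) : Prop :=
  ∀ u : H, ∃ r : ℝ, 0 ≤ r ∧ inner D u (T u) = algebraMap ℝ D r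

/-- `P = |T| = √(T*T)`: `P` is the self-adjoint positive operator with `P P = T* T`. -/
def IsOperatorAbs (P T : H →L[R] H) : Prop :=
  IsSelfAdjointOperator D P ∧ IsPositiveOperator D P ∧
    ∃ S : H →L[R] H, IsAdjointOperator D S T ∧ P.comp P = S.comp T

/-- `T` is of trace class: `∑_{u ∈ N} ⟨u| |T| u⟩ < +∞` for some Hilbert basis `N`. -/
def IsTraceClassOperator (T : H →L[R] H) : Prop :=
  ∃ P : H →L[R] H, IsOperatorAbs D P T ∧
    ∃ N : Set H, IsHilbertBasisSet R D N ∧ Summable fun u : N => inner D (u : H) (P u)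

/-- The `N`-trace `tr_N(T) = ∑_{u ∈ N} ⟨u|Tu⟩`. -/
noncomputable def basisTrace (N : Set H) (T : H →L[R] H) : D :=
  ∑' u : N, inner D (u : H) (T u)

/-- The real trace `Re (tr_N(T))` of a trace-class operator, where `N` is a Hilbert basis. -/
noncomputable def realTrace [RealPart D] (T : H →L[R] H) : ℝ :=
  RealPart.re (basisTrace D (Classical.epsilon fun N : Set H => IsHilbertBasisSet R D N) T)

/-- The real trace of `T` is well defined: `T` is of trace class and, for every Hilbert basis `N`,
the series `tr_N(T)` converges (unconditionally) and `Re (tr_N(T))` is the real trace. -/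
def RealTraceWellDefined [RealPart D] (T : H →L[R] H) : Prop :=
  IsTraceClassOperator D T ∧
    ∀ N : Set H, IsHilbertBasisSet R D N →
      (Summable fun u : N => inner D (u : H) (T u)) ∧
        RealPart.re (basisTrace D N T) = realTrace D T

/-- `P` is an orthogonal projector. -/
def IsOrthogonalProjector (P : H →L[R] H) : Prop :=
  P.comp P = P ∧ IsSelfAdjointOperator D P

/-- `T` is a quantum state: self-adjoint, positive, of trace class and with unit trace. -/
def IsQuantumState (T : H →L[R] H) : Prop :=
  IsSelfAdjointOperator D T ∧ IsPositiveOperator D T ∧ IsTraceClassOperator D T ∧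
    ∀ N : Set H, IsHilbertBasisSet R D N → HasSum (fun u : N => inner D (u : H) (T u)) 1

end Operators

section Representations

variable {R : Type*} {H : Type*} [Ring R] [NormedAddCommGroup H] [Module R H]

/-- A unitary representation (a homomorphism into the group of norm-preserving linear bijections)
is strongly continuous if all its orbit maps `g ↦ U_g x` are continuous. -/
def IsStronglyContinuous {G : Type*} [Group G] [TopologicalSpace G] (U : G →* (H ≃ₗᵢ[R] H)) :
    Prop :=
  ∀ x : H, Continuous fun g : G => U g x

/-- The bounded operator `A V B V⁻¹`, for a unitary operator `V`. -/
noncomputable def mulConj (A B : H →L[R] H) (V : H ≃ₗᵢ[R] H) : H →L[R] H :=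
  A.comp ((V.toContinuousLinearEquiv : H →L[R] H).comp
    (B.comp (V.symm.toContinuousLinearEquiv : H →L[R] H)))

end Representations

/-! Write `B = K K` with `K` self-adjoint; since `B` has finite trace, `K` is Hilbert–Schmidt. For
unitary `V` the operator `A V B V⁻¹ = (A V K)(K V⁻¹)` is then a product of two Hilbert–Schmidt
operators, hence of trace class, and cyclicity turns its trace into `∑ᵢ ⟪V K bᵢ, A V K bᵢ⟫` over one
fixed basis. With `V = U g`, each term is continuous in `g` and bounded by `‖A‖ ‖K bᵢ‖²`, so the sum
is continuous.

The three kinds of scalars are treated together over `ℝ`. If the `e_k` form an orthonormal real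
basis of `D`, the vectors `u e_k` with `u ∈ N` form a real Hilbert basis, and the real trace is the
trace of the underlying real operator divided by the real dimension of `D`. A real operator is
`R`-linear once it commutes with the scalars; this is why `exists_sqrt_of_isPositive` yields a root
commuting with everything that commutes with `T`. That root comes from a power series with Catalan
coefficients. The other main lemmas are `IsHilbertSchmidt.hasSum_inner_mul_comm` and
`RealCoordinates.realTrace_mulConj`. -/

/-! ### The Catalan series and a square root of `1 - x`. -/

theorem sum_range_catalan_div_four_pow_le (n : ℕ) :
    ∑ i ∈ Finset.range n, (catalan i : ℝ) / 4 ^ i ≤ 2 := by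
  induction n with
  | zero => simp
  | succ n ih =>
    have hnn : ∀ i : ℕ, (0 : ℝ) ≤ (catalan i : ℝ) / 4 ^ i := fun i => by positivity
    have hs : 0 ≤ ∑ i ∈ Finset.range n, (catalan i : ℝ) / 4 ^ i :=
      Finset.sum_nonneg fun i _ => hnn i
    -- The Catalan recursion makes the left side a sum over pairs of indices with sum `< n`; these
    -- all lie in the square that the right side sums over.
    have key : ∑ i ∈ Finset.range n, (catalan (i + 1) : ℝ) / 4 ^ i ≤
        (∑ i ∈ Finset.range n, (catalan i : ℝ) / 4 ^ i) ^ 2 := by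
      have h1 : ∀ i, (catalan (i + 1) : ℝ) / 4 ^ i =
          ∑ p ∈ Finset.HasAntidiagonal.antidiagonal i, ((catalan p.1 : ℝ) / 4 ^ p.1) * (catalan p.2 / 4 ^ p.2) := by
        intro i
        rw [catalan_succ']
        push_cast
        rw [Finset.sum_div]
        refine Finset.sum_congr rfl fun p hp => ?_
        rw [← Finset.HasAntidiagonal.mem_antidiagonal.mp hp, pow_add]
        field_simp
      rw [Finset.sum_congr rfl fun i _ => h1 i, sq, Finset.sum_mul_sum, ← Finset.sum_product',
        Finset.sum_sigma', ← Finset.sum_image (g := fun x : (_ : ℕ) × ℕ × ℕ => x.2)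
          (f := fun p : ℕ × ℕ => ((catalan p.1 : ℝ) / 4 ^ p.1) * (catalan p.2 / 4 ^ p.2))]
      · refine Finset.sum_le_sum_of_subset_of_nonneg (fun p hp => ?_)
          fun p _ _ => mul_nonneg (hnn _) (hnn _)
        simp only [Finset.mem_image, Finset.mem_sigma, Finset.mem_range,
          Finset.HasAntidiagonal.mem_antidiagonal] at hp
        obtain ⟨⟨i, q⟩, ⟨hi, hq⟩, rfl⟩ := hp
        simp only [Finset.mem_product, Finset.mem_range] at hi hq ⊢
        omega
      · rintro ⟨i, p⟩ hp ⟨j, q⟩ hq (rfl : p = q)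
        simp only [Finset.coe_sigma, Set.mem_sigma_iff, Finset.mem_coe,
          Finset.HasAntidiagonal.mem_antidiagonal] at hp hq
        obtain rfl : i = j := hp.2.symm.trans hq.2
        rfl
    rw [Finset.sum_range_succ']
    have h2 : ∑ i ∈ Finset.range n, (catalan (i + 1) : ℝ) / 4 ^ (i + 1) =
        (∑ i ∈ Finset.range n, (catalan (i + 1) : ℝ) / 4 ^ i) / 4 := by
      rw [Finset.sum_div]
      refine Finset.sum_congr rfl fun i _ => ?_
      rw [pow_succ]; field_simp
    rw [h2]
    simp only [catalan_zero, Nat.cast_one, pow_zero, div_one]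
    -- If `S` is the old partial sum, the new one is at most `1 + S ^ 2 / 4`, and `0 ≤ S ≤ 2`.
    nlinarith

theorem summable_catalan_div_four_pow : Summable fun n => (catalan n : ℝ) / 4 ^ n :=
  summable_of_sum_range_le (fun i => by positivity) sum_range_catalan_div_four_pow_le

theorem tsum_catalan_div_four_pow_le : ∑' n, (catalan n : ℝ) / 4 ^ n ≤ 2 :=
  summable_catalan_div_four_pow.tsum_le_of_sum_range_le sum_range_catalan_div_four_pow_le

section CatalanSeries

variable {A : Type*} [NormedRing A] [NormedAlgebra ℝ A]

/-- The series `C(x / 4)`, where `C` is the generating function of the Catalan numbers. -/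
noncomputable def catalanSeries (x : A) : A := ∑' n, ((catalan n : ℝ) / 4 ^ n) • x ^ n

theorem norm_catalan_smul_pow_le {x : A} (h1 : ‖(1 : A)‖ ≤ 1) (hx : ‖x‖ ≤ 1) (n : ℕ) :
    ‖((catalan n : ℝ) / 4 ^ n) • x ^ n‖ ≤ (catalan n : ℝ) / 4 ^ n := by
  have hp : ‖x ^ n‖ ≤ 1 := by
    induction n with
    | zero => simpa using h1
    | succ n ih =>
      rw [pow_succ]
      exact (norm_mul_le _ _).trans (mul_le_one₀ ih (norm_nonneg _) hx)
  rw [norm_smul, Real.norm_of_nonneg (by positivity)]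
  exact mul_le_of_le_one_right (by positivity) hp

theorem summable_norm_catalan_smul_pow {x : A} (h1 : ‖(1 : A)‖ ≤ 1) (hx : ‖x‖ ≤ 1) :
    Summable fun n => ‖((catalan n : ℝ) / 4 ^ n) • x ^ n‖ :=
  .of_nonneg_of_le (fun _ => norm_nonneg _) (norm_catalan_smul_pow_le h1 hx)
    summable_catalan_div_four_pow

theorem norm_catalanSeries_le {x : A} (h1 : ‖(1 : A)‖ ≤ 1) (hx : ‖x‖ ≤ 1) :
    ‖catalanSeries x‖ ≤ 2 :=
  (tsum_of_norm_bounded summable_catalan_div_four_pow.hasSum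
    (norm_catalan_smul_pow_le h1 hx)).trans tsum_catalan_div_four_pow_le

theorem Commute.catalanSeries_right {x y : A} (h : Commute y x) : Commute y (catalanSeries x) :=
  Commute.tsum_right _ fun n => (h.pow_right n).smul_right _

/-- This is the functional equation `C = 1 + z C²` of the generating function at `z = x / 4`,
obtained from the Cauchy product. -/
theorem mul_catalanSeries_sq [CompleteSpace A] {x : A} (h1 : ‖(1 : A)‖ ≤ 1) (hx : ‖x‖ ≤ 1) :
    x * (catalanSeries x * catalanSeries x) = (4 : ℝ) • (catalanSeries x - 1) := by
  have hs := summable_norm_catalan_smul_pow h1 hx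
  have hsq : catalanSeries x * catalanSeries x =
      ∑' n, ((catalan (n + 1) : ℝ) / 4 ^ n) • x ^ n := by
    rw [catalanSeries, tsum_mul_tsum_eq_tsum_sum_antidiagonal_of_summable_norm hs hs]
    congr 1
    ext1 n
    have : ∀ p ∈ Finset.HasAntidiagonal.antidiagonal n, (((catalan p.1 : ℝ) / 4 ^ p.1) • x ^ p.1) *
        (((catalan p.2 : ℝ) / 4 ^ p.2) • x ^ p.2) =
        ((catalan p.1 * catalan p.2 : ℝ) / 4 ^ n) • x ^ n := by
      intro p hp
      rw [smul_mul_smul_comm, ← pow_add, ← Finset.HasAntidiagonal.mem_antidiagonal.mp hp, pow_add]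
      congr 1
      field_simp
      ring
    rw [Finset.sum_congr rfl this, ← Finset.sum_smul, ← Finset.sum_div, catalan_succ']
    push_cast
    rfl
  have hsum : Summable fun n => ((catalan n : ℝ) / 4 ^ n) • x ^ n := hs.of_norm
  have hshift : catalanSeries x - 1 = ∑' n, ((catalan (n + 1) : ℝ) / 4 ^ (n + 1)) • x ^ (n + 1) := by
    rw [catalanSeries, hsum.tsum_eq_zero_add]
    simp
  rw [hsq, hshift, ← tsum_const_smul'']
  have hs' : Summable fun n => ((catalan (n + 1) : ℝ) / 4 ^ n) • x ^ n := by
    refine .of_norm (.of_nonneg_of_le (fun _ => norm_nonneg _) (g := fun n => _) (fun n => ?_)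
      (((summable_nat_add_iff 1).mpr summable_catalan_div_four_pow).mul_left 4))
    have hp : ‖x ^ n‖ ≤ 1 := by
      induction n with
      | zero => simpa using h1
      | succ n ih =>
        rw [pow_succ]
        exact (norm_mul_le _ _).trans (mul_le_one₀ ih (norm_nonneg _) hx)
    rw [norm_smul, Real.norm_of_nonneg (by positivity), pow_succ]
    refine (mul_le_of_le_one_right (by positivity) hp).trans (le_of_eq ?_)
    field_simp
  rw [← hs'.tsum_mul_left]
  congr 1
  ext1 n
  rw [smul_smul, mul_smul_comm, ← pow_succ', pow_succ (4 : ℝ)]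
  congr 1
  field_simp

/-- A square root of `1 - x`, for `‖x‖ ≤ 1`. -/
noncomputable def sqrtOneSub (x : A) : A := 1 - (2⁻¹ : ℝ) • (x * catalanSeries x)

theorem sqrtOneSub_mul_self [CompleteSpace A] {x : A} (h1 : ‖(1 : A)‖ ≤ 1) (hx : ‖x‖ ≤ 1) :
    sqrtOneSub x * sqrtOneSub x = 1 - x := by
  have hc : x * catalanSeries x * (x * catalanSeries x) =
      x * ((4 : ℝ) • (catalanSeries x - 1)) := by
    have hc : x * catalanSeries x = catalanSeries x * x :=
      (Commute.refl x).catalanSeries_right.eq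
    rw [← mul_catalanSeries_sq h1 hx]
    simp only [mul_assoc]
    rw [← mul_assoc (catalanSeries x) x, ← hc, mul_assoc]
  rw [sqrtOneSub, sub_mul, mul_sub, mul_sub, smul_mul_smul_comm, hc, mul_smul_comm]
  simp only [one_mul, mul_one, mul_smul_comm, mul_sub]
  module

/-- Serves to show that the square root is a positive operator. -/
theorem norm_one_sub_sqrtOneSub_le {x : A} (h1 : ‖(1 : A)‖ ≤ 1) (hx : ‖x‖ ≤ 1) :
    ‖1 - sqrtOneSub x‖ ≤ 1 := by
  rw [sqrtOneSub, sub_sub_cancel, norm_smul]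
  have h2 := norm_catalanSeries_le h1 hx
  have h3 := norm_mul_le x (catalanSeries x)
  have h4 : ‖x‖ * ‖catalanSeries x‖ ≤ 1 * 2 := by gcongr
  norm_num
  linarith

theorem Commute.sqrtOneSub_right {x y : A} (h : Commute y x) : Commute y (sqrtOneSub x) :=
  (Commute.one_right y).sub_right ((h.mul_right h.catalanSeries_right).smul_right _)

theorem IsSelfAdjoint.sqrtOneSub [StarRing A] [ContinuousStar A] [StarModule ℝ A] {x : A}
    (h : IsSelfAdjoint x) : IsSelfAdjoint (sqrtOneSub x) := by
  have hc : IsSelfAdjoint (catalanSeries x) := by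
    rw [isSelfAdjoint_iff, catalanSeries, tsum_star]
    congr 1
    ext1 n
    exact ((IsSelfAdjoint.all _).smul (h.pow n)).star_eq
  refine (IsSelfAdjoint.one A).sub ((IsSelfAdjoint.all _).smul ?_)
  exact (h.commute_iff hc).mp (Commute.refl x).catalanSeries_right

end CatalanSeries

set_option linter.unusedSectionVars false

/-! ### Positive operators on a real Hilbert space. -/

section RealOperators

open ContinuousLinearMap InnerProductSpace
open scoped RealInnerProductSpace InnerProduct

variable {H : Type*} [NormedAddCommGroup H] [InnerProductSpace ℝ H]

/-- The quadratic polynomial `t ↦ ⟪T (x + t T x), x + t T x⟫` is nonnegative, so its discriminant is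
`≤ 0`; its leading coefficient is at most `‖T x‖²`. -/
theorem ContinuousLinearMap.IsPositive.norm_apply_sq_le {T : H →L[ℝ] H} (hT : T.IsPositive)
    (h1 : ‖T‖ ≤ 1) (x : H) : ‖T x‖ ^ 2 ≤ ⟪T x, x⟫ := by
  have hnn : ∀ y, 0 ≤ ⟪T y, y⟫ := fun y => hT.inner_nonneg_left y
  have hq : ∀ t : ℝ, 0 ≤ ⟪T (T x), T x⟫ * (t * t) + 2 * ‖T x‖ ^ 2 * t + ⟪T x, x⟫ := by
    intro t
    have h := hnn (x + t • T x)
    have hs : ⟪T (T x), x⟫ = ‖T x‖ ^ 2 := by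
      rw [hT.inner_left_eq_inner_right, real_inner_self_eq_norm_sq]
    simp only [map_add, map_smul, inner_add_left, inner_add_right, real_inner_smul_left,
      real_inner_smul_right, hs, real_inner_self_eq_norm_sq] at h
    linarith
  have hd := discrim_le_zero hq
  rw [discrim] at hd
  have hb : ⟪T (T x), T x⟫ ≤ ‖T x‖ ^ 2 := by
    refine (real_inner_le_norm _ _).trans ?_
    rw [sq]
    gcongr
    exact (T.le_of_opNorm_le h1 _).trans_eq (one_mul _)
  rcases (sq_nonneg ‖T x‖).eq_or_lt with h0 | h0
  · rw [← h0]; exact hnn x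
  · have := hnn x
    by_contra! hlt
    nlinarith

variable [CompleteSpace H]

/-- Square roots of positive operators on a real Hilbert space. -/
theorem exists_sqrt_of_isPositive {T : H →L[ℝ] H} (hT : T.IsPositive) :
    ∃ S : H →L[ℝ] H, S.IsPositive ∧ S * S = T ∧ ∀ C : H →L[ℝ] H, Commute C T → Commute C S := by
  wlog h1 : ‖T‖ ≤ 1 generalizing T
  · have hpos : 0 < ‖T‖ := by linarith
    obtain ⟨S, hS, hSS, hC⟩ := this (T := ‖T‖⁻¹ • T) (hT.smul_of_nonneg (by positivity)) (by
      rw [norm_smul, norm_inv, norm_norm, inv_mul_cancel₀ hpos.ne'])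
    refine ⟨√‖T‖ • S, hS.smul_of_nonneg (by positivity), ?_, fun C h => ?_⟩
    · rw [smul_mul_smul_comm, hSS, Real.mul_self_sqrt hpos.le, smul_smul,
        mul_inv_cancel₀ hpos.ne', one_smul]
    · exact (hC C (h.smul_right _)).smul_right _
  have hone : ‖(1 : H →L[ℝ] H)‖ ≤ 1 := norm_id_le
  have hX : ‖1 - T‖ ≤ 1 := by
    refine opNorm_le_bound _ zero_le_one fun x => ?_
    rw [one_mul, ← sq_le_sq₀ (norm_nonneg _) (norm_nonneg _), sub_apply, one_apply_eq_self,
      norm_sub_sq_real, real_inner_comm]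
    have := hT.norm_apply_sq_le h1 x
    nlinarith [sq_nonneg ‖T x‖]
  have hsa : IsSelfAdjoint (sqrtOneSub (1 - T)) := ((IsSelfAdjoint.one _).sub hT.isSelfAdjoint).sqrtOneSub
  refine ⟨sqrtOneSub (1 - T), ?_, ?_, fun C h => ((Commute.one_right C).sub_right h).sqrtOneSub_right⟩
  · refine (isPositive_iff' _).mpr ⟨hsa, fun x => ?_⟩
    have h2 := norm_one_sub_sqrtOneSub_le hone hX
    have h3 : ⟪(1 - sqrtOneSub (1 - T)) x, x⟫ ≤ ‖x‖ ^ 2 := by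
      refine (real_inner_le_norm _ _).trans ?_
      rw [sq]
      gcongr
      exact ((1 - sqrtOneSub (1 - T)).le_of_opNorm_le h2 _).trans_eq (one_mul _)
    rw [sub_apply, one_apply_eq_self, inner_sub_left, real_inner_self_eq_norm_sq] at h3
    linarith
  · rw [sqrtOneSub_mul_self hone hX, sub_sub_cancel]

theorem ContinuousLinearMap.IsPositive.apply_eq_zero {T : H →L[ℝ] H} (hT : T.IsPositive) {x : H}
    (h : ⟪T x, x⟫ = 0) : T x = 0 := by
  obtain ⟨S, hS, rfl, -⟩ := exists_sqrt_of_isPositive hT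
  rw [mul_apply_eq_comp, hS.inner_left_eq_inner_right, real_inner_self_eq_norm_sq] at h
  rw [mul_apply_eq_comp, norm_eq_zero.mp ((pow_eq_zero_iff two_ne_zero).mp h), map_zero]

/-- A positive operator is determined by its square. -/
theorem ContinuousLinearMap.IsPositive.eq_of_mul_self_eq {P Q : H →L[ℝ] H} (hP : P.IsPositive)
    (hQ : Q.IsPositive) (h : P * P = Q * Q) : P = Q := by
  -- In the commuting case `(P + Q)(P - Q) = 0`. Hence `y = P x - Q x` is killed by both `P` and
  -- `Q`, and so `⟪y, P x - Q x⟫ = 0`.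
  have aux : ∀ P Q : H →L[ℝ] H, P.IsPositive → Q.IsPositive → P * P = Q * Q → Commute P Q →
      P = Q := by
    intro P Q hP hQ h hc
    ext x
    set y := P x - Q x with hy
    have hsum : P y + Q y = 0 := by
      have h1 := DFunLike.congr_fun h x
      have h2 := DFunLike.congr_fun hc.eq x
      simp only [mul_apply_eq_comp] at h1 h2
      simp only [hy, map_sub, h1, h2]
      abel
    have h3 : ⟪P y, y⟫ + ⟪Q y, y⟫ = 0 := by rw [← inner_add_left, hsum, inner_zero_left]
    have h4 := hP.inner_nonneg_left y
    have h5 := hQ.inner_nonneg_left y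
    have h6 : P y = 0 := hP.apply_eq_zero (by linarith)
    have h7 : Q y = 0 := hQ.apply_eq_zero (by linarith)
    have h8 : ⟪y, y⟫ = 0 := by
      nth_rw 2 [hy]
      rw [inner_sub_right, ← hP.inner_left_eq_inner_right, ← hQ.inner_left_eq_inner_right, h6, h7]
      simp
    exact sub_eq_zero.mp (inner_self_eq_zero.mp h8)
  -- Both `P` and `Q` commute with their common square, hence with its root `S`; the commuting case
  -- then gives `P = S` and `Q = S`.
  obtain ⟨S, hS, hSS, hC⟩ := exists_sqrt_of_isPositive
    (T := Q * Q) (by simpa [hQ.isSelfAdjoint.adjoint_eq] using! isPositive_adjoint_comp_self Q)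
  rw [aux Q S hQ hS hSS.symm (hC Q ((Commute.refl Q).mul_right (Commute.refl Q)))]
  exact aux P S hP hS (h.trans hSS.symm) (hC P (h ▸ (Commute.refl P).mul_right (Commute.refl P)))

/-- A bounded operator factors through any operator with the same norms. -/
theorem exists_mul_eq_of_norm_apply_eq {T Q : H →L[ℝ] H} (h : ∀ x, ‖T x‖ = ‖Q x‖) :
    ∃ W : H →L[ℝ] H, W * T = Q := by
  -- The rule `T x ↦ Q x` is isometric on the range of `T`; it extends to the closure `K` and is
  -- precomposed with the projection onto `K`.
  let K := (LinearMap.range (T : H →ₗ[ℝ] H)).topologicalClosure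
  let e : H →ₗ[ℝ] K := (T : H →ₗ[ℝ] H).codRestrict K
    fun x => Submodule.le_topologicalClosure _ ⟨x, rfl⟩
  have he : DenseRange e := by
    rintro ⟨y, hy⟩
    rw [closure_subtype]
    have hr : Subtype.val '' Set.range e = Set.range T := by
      ext z
      constructor
      · rintro ⟨_, ⟨x, rfl⟩, rfl⟩
        exact ⟨x, rfl⟩
      · rintro ⟨x, rfl⟩
        exact ⟨_, ⟨x, rfl⟩, rfl⟩
    rw [hr]
    exact hy
  have hK : CompleteSpace K :=
    (Submodule.isClosed_topologicalClosure _).completeSpace_coe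
  refine ⟨((Q : H →ₗ[ℝ] H).extendOfNorm e).comp K.orthogonalProjectionOnto, ?_⟩
  ext x
  have hx : K.orthogonalProjectionOnto (T x) = e x :=
    Submodule.orthogonalProjectionOnto_mem_subspace_eq_self (e x)
  rw [mul_apply_eq_comp, comp_apply, hx, LinearMap.extendOfNorm_eq he]
  · rfl
  · exact ⟨1, fun x => by rw [one_mul]; exact (h x).ge⟩

/-! ### Hilbert–Schmidt operators and traces. -/

/-- The Hilbert–Schmidt property, relative to a Hilbert basis. -/
def IsHilbertSchmidt {ι : Type*} (b : HilbertBasis ι ℝ H) (T : H →L[ℝ] H) : Prop :=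
  Summable fun i => ‖T (b i)‖ ^ 2

variable {ι κ : Type*}

theorem HilbertBasis.ofReal_norm_sq_eq_tsum (b : HilbertBasis ι ℝ H) (x : H) :
    ENNReal.ofReal (‖x‖ ^ 2) = ∑' i, ENNReal.ofReal (⟪b i, x⟫ ^ 2) := by
  have hs := b.hasSum_inner_mul_inner x x
  simp only [real_inner_self_eq_norm_sq, real_inner_comm _ x, ← sq] at hs
  rw [← hs.tsum_eq, ENNReal.ofReal_tsum_of_nonneg (fun _ => sq_nonneg _) hs.summable]

/-- By Parseval both sides are the double sum of `⟪c k, T (b i)⟫ ^ 2`; in `ENNReal` the order of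
summation is free. -/
theorem tsum_ofReal_norm_sq_eq_adjoint (b : HilbertBasis ι ℝ H) (c : HilbertBasis κ ℝ H)
    (T : H →L[ℝ] H) :
    ∑' i, ENNReal.ofReal (‖T (b i)‖ ^ 2) = ∑' k, ENNReal.ofReal (‖(T†) (c k)‖ ^ 2) := by
  simp_rw [c.ofReal_norm_sq_eq_tsum (T _), b.ofReal_norm_sq_eq_tsum ((T†) _)]
  rw [ENNReal.tsum_comm]
  simp_rw [adjoint_inner_right, real_inner_comm]

theorem isHilbertSchmidt_iff_tsum_ne_top {b : HilbertBasis ι ℝ H} {T : H →L[ℝ] H} :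
    IsHilbertSchmidt b T ↔ ∑' i, ENNReal.ofReal (‖T (b i)‖ ^ 2) ≠ ⊤ := by
  refine ⟨fun h => h.tsum_ofReal_ne_top, fun h => ?_⟩
  simpa [ENNReal.toReal_ofReal (sq_nonneg _)] using! ENNReal.summable_toReal h

theorem isHilbertSchmidt_adjoint_iff (b : HilbertBasis ι ℝ H) (c : HilbertBasis κ ℝ H)
    {T : H →L[ℝ] H} : IsHilbertSchmidt c (T†) ↔ IsHilbertSchmidt b T := by
  rw [isHilbertSchmidt_iff_tsum_ne_top, isHilbertSchmidt_iff_tsum_ne_top,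
    tsum_ofReal_norm_sq_eq_adjoint b c T]

theorem tsum_norm_sq_eq_adjoint (b : HilbertBasis ι ℝ H) (c : HilbertBasis κ ℝ H)
    (T : H →L[ℝ] H) : ∑' i, ‖T (b i)‖ ^ 2 = ∑' k, ‖(T†) (c k)‖ ^ 2 := by
  have h := congrArg ENNReal.toReal (tsum_ofReal_norm_sq_eq_adjoint b c T)
  rw [ENNReal.tsum_toReal_eq fun _ => ENNReal.ofReal_ne_top,
    ENNReal.tsum_toReal_eq fun _ => ENNReal.ofReal_ne_top] at h
  simpa only [ENNReal.toReal_ofReal (sq_nonneg _)] using h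

namespace IsHilbertSchmidt

variable {b : HilbertBasis ι ℝ H} {S T : H →L[ℝ] H}

theorem adjoint (h : IsHilbertSchmidt b T) (c : HilbertBasis κ ℝ H) : IsHilbertSchmidt c (T†) :=
  (isHilbertSchmidt_adjoint_iff b c).mpr h

theorem change_basis (h : IsHilbertSchmidt b T) (c : HilbertBasis κ ℝ H) :
    IsHilbertSchmidt c T := by
  simpa using (h.adjoint b).adjoint c

theorem mul_left (h : IsHilbertSchmidt b T) (A : H →L[ℝ] H) : IsHilbertSchmidt b (A * T) := by
  refine .of_nonneg_of_le (fun _ => sq_nonneg _) (fun i => ?_) (Summable.mul_left (‖A‖ ^ 2) h)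
  rw [← mul_pow]
  gcongr
  exact A.le_opNorm _

theorem mul_right (h : IsHilbertSchmidt b T) (A : H →L[ℝ] H) : IsHilbertSchmidt b (T * A) := by
  rw [← isHilbertSchmidt_adjoint_iff b b, mul_def, adjoint_comp]
  exact (h.adjoint b).mul_left (A†)

theorem add (hS : IsHilbertSchmidt b S) (hT : IsHilbertSchmidt b T) :
    IsHilbertSchmidt b (S + T) := by
  refine .of_nonneg_of_le (fun _ => sq_nonneg _) (fun i => ?_)
    (Summable.mul_left 2 (Summable.add hS hT))
  rw [add_apply]
  have h1 := norm_add_le (S (b i)) (T (b i))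
  have h2 := norm_nonneg (S (b i) + T (b i))
  nlinarith [sq_nonneg (‖S (b i)‖ - ‖T (b i)‖)]

theorem neg (hT : IsHilbertSchmidt b T) : IsHilbertSchmidt b (-T) := by
  simpa [IsHilbertSchmidt] using! hT

theorem sub (hS : IsHilbertSchmidt b S) (hT : IsHilbertSchmidt b T) :
    IsHilbertSchmidt b (S - T) := by
  rw [sub_eq_add_neg]
  exact hS.add hT.neg

/-- The polarization identity for the Hilbert–Schmidt scalar product. -/
theorem hasSum_inner (hS : IsHilbertSchmidt b S) (hT : IsHilbertSchmidt b T) :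
    HasSum (fun i => ⟪S (b i), T (b i)⟫)
      ((∑' i, ‖(S + T) (b i)‖ ^ 2 - ∑' i, ‖(S - T) (b i)‖ ^ 2) / 4) := by
  convert! ((hS.add hT).hasSum.sub (hS.sub hT).hasSum).div_const 4 using 2 with i
  rw [add_apply, sub_apply, norm_add_sq_real, norm_sub_sq_real]
  ring

/-- The cyclicity of the trace for Hilbert–Schmidt operators. -/
theorem hasSum_inner_mul_comm (hS : IsHilbertSchmidt b S) (hT : IsHilbertSchmidt b T)
    (c : HilbertBasis κ ℝ H) :
    HasSum (fun k => ⟪c k, (S * T) (c k)⟫) (∑' i, ⟪b i, (T * S) (b i)⟫) := by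
  -- Polarization reduces both traces to Hilbert–Schmidt norms of `S† ± T` and of the adjoints of
  -- these, which agree for any two bases.
  have h1 := (hS.adjoint c).hasSum_inner (hT.change_basis c)
  have h2 := (hT.adjoint b).hasSum_inner hS
  simp only [adjoint_inner_left, ← mul_apply_eq_comp] at h1 h2
  rw [h2.tsum_eq]
  convert! h1 using 3
  · rw [tsum_norm_sq_eq_adjoint b c, map_add, adjoint_adjoint, add_comm]
  · rw [tsum_norm_sq_eq_adjoint b c, map_sub, adjoint_adjoint]
    simp only [sub_apply, norm_sub_rev]

end IsHilbertSchmidt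

/-- If `T` is the product of two Hilbert–Schmidt operators, then `|T|` has finite trace. -/
theorem IsHilbertSchmidt.summable_inner_of_mul_self_eq {b : HilbertBasis ι ℝ H} {S T Q : H →L[ℝ] H}
    (hS : IsHilbertSchmidt b S) (hT : IsHilbertSchmidt b T) (hQ : Q.IsPositive)
    (h : Q * Q = ((S * T)†) * (S * T)) : Summable fun i => ⟪b i, Q (b i)⟫ := by
  -- As in the polar decomposition, `‖Q x‖ = ‖S T x‖` gives `Q = (W S) T`, again a product of
  -- Hilbert–Schmidt operators.
  obtain ⟨W, hW⟩ := exists_mul_eq_of_norm_apply_eq (T := S * T) (Q := Q) (fun x => by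
    rw [← sq_eq_sq₀ (norm_nonneg _) (norm_nonneg _), ← real_inner_self_eq_norm_sq,
      ← real_inner_self_eq_norm_sq, ← hQ.inner_left_eq_inner_right, ← mul_apply_eq_comp Q Q, h,
      mul_apply_eq_comp ((S * T)†), adjoint_inner_left])
  rw [← hW, ← mul_assoc]
  exact ((hS.mul_left W).hasSum_inner_mul_comm hT b).summable

/-- A positive operator with finite trace has a Hilbert–Schmidt square root. -/
theorem exists_isHilbertSchmidt_mul_self_eq {b : HilbertBasis ι ℝ H} {T : H →L[ℝ] H}
    (hT : T.IsPositive) (h : Summable fun i => ⟪b i, T (b i)⟫) :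
    ∃ K : H →L[ℝ] H, IsHilbertSchmidt b K ∧ IsSelfAdjoint K ∧ K * K = T := by
  obtain ⟨K, hK, rfl, -⟩ := exists_sqrt_of_isPositive hT
  refine ⟨K, ?_, hK.isSelfAdjoint, rfl⟩
  refine h.congr fun i => ?_
  rw [mul_apply_eq_comp, ← hK.inner_left_eq_inner_right, real_inner_self_eq_norm_sq]

/-- The trace of `A V K K V⁻¹`, for a unitary operator `V` and a Hilbert–Schmidt operator `K`. -/
theorem IsHilbertSchmidt.hasSum_inner_conj {b : HilbertBasis ι ℝ H} {K : H →L[ℝ] H}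
    (hK : IsHilbertSchmidt b K) (hKs : IsSelfAdjoint K) (A V V' : H →L[ℝ] H) (hV : V† = V')
    (c : HilbertBasis κ ℝ H) :
    HasSum (fun k => ⟪c k, (A * (V * (K * K * V'))) (c k)⟫)
      (∑' i, ⟪V (K (b i)), A (V (K (b i)))⟫) := by
  convert! ((hK.mul_left (A * V)).hasSum_inner_mul_comm (hK.mul_right V') c) using 1
  refine tsum_congr fun i => ?_
  simp only [mul_apply_eq_comp]
  rw [← adjoint_inner_left K, hKs.adjoint_eq, ← hV, adjoint_inner_right]

/-- Weierstrass test: the bound `‖A‖ ‖K (b i)‖ ^ 2` is summable and independent of `g`. -/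
theorem IsHilbertSchmidt.continuous_tsum_inner {G : Type*} [TopologicalSpace G]
    {b : HilbertBasis ι ℝ H} {K : H →L[ℝ] H} (hK : IsHilbertSchmidt b K) (A : H →L[ℝ] H)
    {V : G → H → H} (hV : ∀ x, Continuous fun g => V g x) (hn : ∀ g x, ‖V g x‖ = ‖x‖) :
    Continuous fun g => ∑' i, ⟪V g (K (b i)), A (V g (K (b i)))⟫ := by
  refine continuous_tsum (fun i => (hV _).inner (A.continuous.comp (hV _)))
    (Summable.mul_left ‖A‖ hK) fun i g => ?_
  refine (norm_inner_le_norm _ _).trans ?_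
  have := A.le_opNorm (V g (K (b i)))
  rw [hn] at this ⊢
  nlinarith [norm_nonneg (K (b i))]

end RealOperators

/-! ### Passage between `R`-linear and real-linear operators. -/

section Realification

open ContinuousLinearMap
open scoped RealInnerProductSpace InnerProduct

/-- A bounded operator, seen as a bounded real-linear operator. -/
noncomputable def ContinuousLinearMap.toReal {R H : Type*} [Ring R] [NormedAddCommGroup H]
    [InnerProductSpace ℝ H] [Module R H] (T : H →L[R] H) : H →L[ℝ] H :=
  (T : H →+ H).toRealLinearMap T.continuous

@[simp]
theorem ContinuousLinearMap.toReal_apply {R H : Type*} [Ring R] [NormedAddCommGroup H]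
    [InnerProductSpace ℝ H] [Module R H] (T : H →L[R] H) (x : H) : T.toReal x = T x := rfl

theorem LinearIsometryEquiv.adjoint_toReal {R H : Type*} [Ring R] [NormedAddCommGroup H]
    [InnerProductSpace ℝ H] [Module R H] [CompleteSpace H] (V : H ≃ₗᵢ[R] H) :
    (V.toContinuousLinearEquiv : H →L[R] H).toReal† =
      (V.symm.toContinuousLinearEquiv : H →L[R] H).toReal := by
  symm
  rw [eq_adjoint_iff]
  intro x y
  let W : H →ₗᵢ[ℝ] H :=
    ⟨((V.toContinuousLinearEquiv : H →L[R] H).toReal : H →ₗ[ℝ] H), V.norm_map⟩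
  have h : ∀ z, W z = V z := fun _ => rfl
  have := W.inner_map_map (V.symm x) y
  rw [h, h, V.apply_symm_apply] at this
  exact this.symm

/-- The description of a scalar product with values in the algebra `D` by the underlying real
scalar product and finitely many real-unitary scalars `unit k`, where `κ` indexes an orthonormal
real basis of `D`. -/
structure RealCoordinates (R D H κ : Type*) [Ring R] [NormedRing D] [NormedAlgebra ℝ D]
    [RealPart D] [NormedAddCommGroup H] [InnerProductSpace ℝ H] [Module R H] [Inner D H]
    [Fintype κ] where
  coord : κ → D →L[ℝ] ℝ
  basis : κ → D
  sum_coord_smul_basis : ∀ d, ∑ k, coord k d • basis k = d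
  unit : κ → R
  one : κ
  unit_one : unit one = 1
  coord_one_algebraMap : ∀ r, coord one (algebraMap ℝ D r) = r
  coord_algebraMap : ∀ r k, k ≠ one → coord k (algebraMap ℝ D r) = 0
  re_eq_coord : ∀ d : D, RealPart.re d = coord one d
  coord_inner : ∀ k (x y : H), coord k (inner D x y) = ⟪unit k • x, y⟫
  inner_unit_smul : ∀ k (x y : H), ⟪unit k • x, unit k • y⟫ = ⟪x, y⟫
  inner_unit_smul_of_ne : ∀ k l (x : H), k ≠ l → ⟪unit k • x, unit l • x⟫ = 0
  exists_smul_eq_sum : ∀ r : R, ∃ c : κ → ℝ, ∀ x : H, r • x = ∑ k, c k • unit k • x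
  exists_adjoint_smul : ∀ r : R, ∃ s : R, ∀ x y : H, ⟪r • x, y⟫ = ⟪x, s • y⟫

namespace RealCoordinates

variable {R D H κ : Type*} [Ring R] [NormedRing D] [NormedAlgebra ℝ D]
    [RealPart D] [NormedAddCommGroup H] [InnerProductSpace ℝ H] [Module R H] [Inner D H]
    [Fintype κ] (m : RealCoordinates R D H κ)

include m

theorem ext_coord {a b : D} (h : ∀ k, m.coord k a = m.coord k b) : a = b := by
  rw [← m.sum_coord_smul_basis a, ← m.sum_coord_smul_basis b]
  simp only [h]

theorem coord_one_inner (x y : H) : m.coord m.one (inner D x y) = ⟪x, y⟫ := by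
  rw [m.coord_inner, m.unit_one, one_smul]

theorem continuous_smul (r : R) : Continuous fun x : H => r • x := by
  obtain ⟨c, hc⟩ := m.exists_smul_eq_sum r
  simp only [hc]
  refine continuous_finsetSum _ fun k _ => Continuous.const_smul ?_ _
  refine (AddMonoidHomClass.isometry_of_norm
    (DistribSMul.toAddMonoidHom H (m.unit k)) fun x => ?_).continuous
  rw [← sq_eq_sq₀ (norm_nonneg _) (norm_nonneg _), ← real_inner_self_eq_norm_sq,
    ← real_inner_self_eq_norm_sq]
  exact m.inner_unit_smul k x x

/-- The multiplication by a scalar. -/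
noncomputable def smulCLM (r : R) : H →L[ℝ] H :=
  (DistribSMul.toAddMonoidHom H r).toRealLinearMap (m.continuous_smul r)

@[simp]
theorem smulCLM_apply (r : R) (x : H) : m.smulCLM r x = r • x := rfl

theorem smul_real_smul (r : R) (t : ℝ) (x : H) : r • t • x = t • r • x :=
  (m.smulCLM r).map_smul t x

theorem commute_smulCLM (T : H →L[R] H) (r : R) : Commute (m.smulCLM r) T.toReal := by
  ext x
  simp [mul_apply_eq_comp]

/-- Brings adjoints and square roots, built over `ℝ`, back to `R`-linear operators. -/
theorem exists_toReal_eq {S : H →L[ℝ] H} (h : ∀ r, Commute (m.smulCLM r) S) :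
    ∃ T : H →L[R] H, T.toReal = S :=
  ⟨{ toFun := S
     map_add' := S.map_add
     map_smul' := fun r x => (DFunLike.congr_fun (h r).eq x).symm
     cont := S.continuous }, rfl⟩

theorem isAdjointOperator_iff [CompleteSpace H] {S T : H →L[R] H} :
    IsAdjointOperator D S T ↔ S.toReal = T.toReal† := by
  rw [eq_adjoint_iff]
  refine ⟨fun h x y => ?_, fun h x y => m.ext_coord fun k => ?_⟩
  · have := congrArg (m.coord m.one) (h x y)
    rwa [m.coord_one_inner, m.coord_one_inner] at this
  · rw [m.coord_inner, m.coord_inner, ← map_smul]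
    exact h _ _

theorem isPositive_toReal [CompleteSpace H] {T : H →L[R] H} (h : IsSelfAdjointOperator D T)
    (hT : IsPositiveOperator D T) : T.toReal.IsPositive := by
  refine (isPositive_iff' _).mpr ⟨(m.isAdjointOperator_iff.mp h).symm, fun x => ?_⟩
  obtain ⟨r, hr, h⟩ := hT x
  rw [real_inner_comm, toReal_apply, ← m.coord_one_inner, h, m.coord_one_algebraMap]
  exact hr

theorem isSelfAdjointOperator_of_isPositive [CompleteSpace H] {T : H →L[R] H}
    (h : T.toReal.IsPositive) : IsSelfAdjointOperator D T :=
  m.isAdjointOperator_iff.mpr h.isSelfAdjoint.adjoint_eq.symm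

theorem inner_unit_smul_self {k : κ} (hk : k ≠ m.one) (x : H) : ⟪m.unit k • x, x⟫ = 0 := by
  simpa [m.unit_one] using m.inner_unit_smul_of_ne k m.one x hk

/-- For `k ≠ m.one` the unit acts as a skew operator commuting with the symmetric `T`, so `⟪m.unit k
• x, T x⟫` equals its own negative. -/
theorem inner_apply_self_eq [CompleteSpace H] {T : H →L[R] H} (h : T.toReal.IsPositive) (x : H) :
    inner D x (T x) = algebraMap ℝ D ⟪x, T x⟫ := by
  refine m.ext_coord fun k => ?_
  by_cases hk : k = m.one
  · rw [hk, m.coord_one_inner, m.coord_one_algebraMap]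
  · rw [m.coord_algebraMap _ _ hk, m.coord_inner]
    have hskew : ∀ y z : H, ⟪m.unit k • y, z⟫ = - ⟪m.unit k • z, y⟫ := by
      intro y z
      have := m.inner_unit_smul_self hk (y + z)
      rw [smul_add, inner_add_left, inner_add_right, inner_add_right, m.inner_unit_smul_self hk,
        m.inner_unit_smul_self hk] at this
      linarith
    have h1 : ⟪m.unit k • x, T x⟫ = ⟪m.unit k • T x, x⟫ := by
      rw [← map_smul]
      exact (h.inner_left_eq_inner_right _ _).symm
    linarith [hskew x (T x)]

theorem isPositiveOperator_of_isPositive [CompleteSpace H] {T : H →L[R] H}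
    (h : T.toReal.IsPositive) : IsPositiveOperator D T := fun x =>
  ⟨⟪x, T x⟫, h.inner_nonneg_right x, m.inner_apply_self_eq h x⟩

theorem exists_toReal_eq_adjoint [CompleteSpace H] (T : H →L[R] H) :
    ∃ S : H →L[R] H, S.toReal = T.toReal† := by
  refine m.exists_toReal_eq fun r => ?_
  obtain ⟨s, hs⟩ := m.exists_adjoint_smul r
  ext x
  refine ext_inner_right ℝ fun y => ?_
  simp only [mul_apply_eq_comp, smulCLM_apply, hs, adjoint_inner_left, toReal_apply, map_smul]

/-- The existence of the absolute value. -/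
theorem exists_isOperatorAbs [CompleteSpace H] (T : H →L[R] H) :
    ∃ P : H →L[R] H, IsOperatorAbs D P T ∧ P.toReal.IsPositive ∧
      P.toReal * P.toReal = T.toReal† * T.toReal := by
  obtain ⟨S, hS⟩ := m.exists_toReal_eq_adjoint T
  obtain ⟨Q, hQ, hQQ, hC⟩ := exists_sqrt_of_isPositive (isPositive_adjoint_comp_self T.toReal)
  -- The operator `T† T` commutes with the scalars, hence so does its root `Q`.
  obtain ⟨P, rfl⟩ := m.exists_toReal_eq (S := Q) fun r => hC _ (by
    rw [← hS]
    exact (m.commute_smulCLM S r).mul_right (m.commute_smulCLM T r))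
  refine ⟨P, ⟨m.isSelfAdjointOperator_of_isPositive hQ, m.isPositiveOperator_of_isPositive hQ,
    S, m.isAdjointOperator_iff.mpr hS, ?_⟩, hQ, hQQ⟩
  ext x
  rw [← hS] at hQQ
  exact DFunLike.congr_fun hQQ x

theorem orthonormal {N : Set H} (hN : IsHilbertBasisSet R D N) :
    Orthonormal ℝ fun p : N × κ => m.unit p.2 • (p.1 : H) := by
  refine ⟨fun p => ?_, fun p q hpq => ?_⟩
  · rw [← sq_eq_sq₀ (norm_nonneg _) zero_le_one, ← real_inner_self_eq_norm_sq, m.inner_unit_smul,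
      ← m.coord_one_inner, hN.inner_self_eq_one _ p.1.2, ← map_one (algebraMap ℝ D),
      m.coord_one_algebraMap, one_pow]
  · obtain ⟨u, k⟩ := p
    obtain ⟨v, l⟩ := q
    change ⟪m.unit k • (u : H), m.unit l • (v : H)⟫ = 0
    by_cases huv : u = v
    · subst huv
      exact m.inner_unit_smul_of_ne k l _ fun h => hpq (by rw [h])
    · obtain ⟨s, hs⟩ := m.exists_adjoint_smul (m.unit l)
      obtain ⟨c, hc⟩ := m.exists_smul_eq_sum (s * m.unit k)
      -- Moving both units to `u` gives a real combination of the coordinates of `⟨u|v⟩ = 0`.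
      rw [real_inner_comm, hs, smul_smul, hc, inner_sum]
      refine Finset.sum_eq_zero fun j _ => ?_
      rw [real_inner_smul_right, real_inner_comm, ← m.coord_inner,
        hN.inner_eq_zero u u.2 v v.2 fun h => huv (Subtype.ext h), map_zero, mul_zero]

/-- The real span of the vectors `u e_k` is stable under `R`, so it contains the dense `R`-span of
`N`. -/
theorem dense_span {N : Set H} (hN : IsHilbertBasisSet R D N) :
    ⊤ ≤ (Submodule.span ℝ
      (Set.range fun p : N × κ => m.unit p.2 • (p.1 : H))).topologicalClosure := by
  set p := Submodule.span ℝ (Set.range fun p : N × κ => m.unit p.2 • (p.1 : H)) with hp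
  have hunit : ∀ u ∈ N, ∀ r : R, r • u ∈ p := by
    intro u hu r
    obtain ⟨c, hc⟩ := m.exists_smul_eq_sum r
    rw [hc]
    exact sum_mem fun k _ => p.smul_mem _ (Submodule.subset_span ⟨(⟨u, hu⟩, k), rfl⟩)
  have hsmul : ∀ r : R, ∀ x ∈ p, r • x ∈ p := by
    intro r x hx
    induction hx using Submodule.span_induction with
    | mem x h =>
      obtain ⟨q, rfl⟩ := h
      rw [smul_smul]
      exact hunit _ q.1.2 _
    | zero => rw [smul_zero]; exact p.zero_mem
    | add x y _ _ hx hy => rw [smul_add]; exact p.add_mem hx hy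
    | smul t x _ hx => rw [m.smul_real_smul]; exact p.smul_mem t hx
  have hle : ∀ x ∈ Submodule.span R N, x ∈ p := by
    intro x hx
    induction hx using Submodule.span_induction with
    | mem x h => simpa using hunit x h 1
    | zero => exact p.zero_mem
    | add x y _ _ hx hy => exact p.add_mem hx hy
    | smul r x _ hx => exact hsmul r x hx
  exact fun x _ => (hN.dense_span.mono hle) x

/-- The real Hilbert basis `{u e_k}`, for `u ∈ N`. -/
noncomputable def hilbertBasis [CompleteSpace H] {N : Set H} (hN : IsHilbertBasisSet R D N) :
    HilbertBasis (N × κ) ℝ H :=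
  HilbertBasis.mk (m.orthonormal hN) (m.dense_span hN)

theorem hilbertBasis_apply [CompleteSpace H] {N : Set H} (hN : IsHilbertBasisSet R D N)
    (p : N × κ) : m.hilbertBasis hN p = m.unit p.2 • (p.1 : H) := by
  rw [hilbertBasis, HilbertBasis.coe_mk]

theorem inner_hilbertBasis [CompleteSpace H] {N : Set H} (hN : IsHilbertBasisSet R D N)
    (T : H →L[R] H) (p : N × κ) :
    ⟪m.hilbertBasis hN p, T.toReal (m.hilbertBasis hN p)⟫ = ⟪(p.1 : H), T p.1⟫ := by
  rw [m.hilbertBasis_apply, toReal_apply, map_smul, m.inner_unit_smul]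

theorem summable_of_coord {α : Type*} {f : α → D} (h : ∀ k, Summable fun a => m.coord k (f a)) :
    Summable f := by
  have : Summable fun a => ∑ k, m.coord k (f a) • m.basis k :=
    summable_sum fun k _ => (h k).smul_const _
  simpa only [m.sum_coord_smul_basis] using this

theorem summable_inner_apply_of_isPositive [CompleteSpace H] {N : Set H}
    (hN : IsHilbertBasisSet R D N) {P : H →L[R] H} (hP : P.toReal.IsPositive) :
    (Summable fun u : N => inner D (u : H) (P u)) ↔
      Summable fun p => ⟪m.hilbertBasis hN p, P.toReal (m.hilbertBasis hN p)⟫ := by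
  simp only [m.inner_hilbertBasis, m.inner_apply_self_eq hP]
  constructor
  · intro h
    have h' := h.mapL (m.coord m.one)
    simp only [m.coord_one_algebraMap] at h'
    simpa using h'.mul_of_nonneg (hasSum_fintype fun _ : κ => (1 : ℝ)).summable
      (fun u => hP.inner_nonneg_right _) (fun _ => zero_le_one)
  · intro h
    have h' := h.comp_injective (Prod.mk_left_injective m.one)
    simpa only [Algebra.algebraMap_eq_smul_one] using! h'.smul_const (1 : D)

/-- The `k`-th coordinate of `⟨u|T u⟩` is `⟪u, s X Y u⟫`, with `s` adjoint to the unit, and `s X` is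
still Hilbert–Schmidt. Restricting to the vectors `u e_k` with `e_k = 1` leaves the sum over `N`. -/
theorem summable_inner_apply [CompleteSpace H] {ι : Type*} {b : HilbertBasis ι ℝ H}
    {X Y : H →L[ℝ] H} (hX : IsHilbertSchmidt b X) (hY : IsHilbertSchmidt b Y) {T : H →L[R] H}
    (hT : T.toReal = X * Y) {N : Set H} (hN : IsHilbertBasisSet R D N) :
    Summable fun u : N => inner D (u : H) (T u) := by
  refine m.summable_of_coord fun k => ?_
  obtain ⟨s, hs⟩ := m.exists_adjoint_smul (m.unit k)
  have h := ((hX.mul_left (m.smulCLM s)).hasSum_inner_mul_comm hY (m.hilbertBasis hN)).summable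
  rw [mul_assoc, ← hT] at h
  have h' := h.comp_injective (Prod.mk_left_injective m.one)
  simpa [Function.comp_def, m.coord_inner, hs, m.hilbertBasis_apply, m.unit_one,
    mul_apply_eq_comp] using! h'

/-- Each `u ∈ N` contributes one equal term for every `k : κ` to the real trace. -/
theorem re_basisTrace_eq [CompleteSpace H] {N : Set H} (hN : IsHilbertBasisSet R D N)
    {T : H →L[R] H} (h : Summable fun u : N => inner D (u : H) (T u)) {t : ℝ}
    (ht : HasSum (fun p => ⟪m.hilbertBasis hN p, T.toReal (m.hilbertBasis hN p)⟫) t) :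
    RealPart.re (basisTrace D N T) = t / Fintype.card κ := by
  have : Nonempty κ := ⟨m.one⟩
  rw [m.re_eq_coord, basisTrace, ContinuousLinearMap.map_tsum _ h]
  simp only [m.coord_one_inner, m.inner_hilbertBasis] at ht ⊢
  rw [eq_div_iff (by simp), ← ht.tsum_eq, ht.summable.tsum_prod]
  simp [tsum_mul_left, mul_comm]

theorem toReal_eq_of_isOperatorAbs [CompleteSpace H] {P T : H →L[R] H}
    (hT : IsSelfAdjointOperator D T) (hpos : IsPositiveOperator D T) (hP : IsOperatorAbs D P T) :
    P.toReal = T.toReal := by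
  obtain ⟨hPs, hPp, S, hS, hPP⟩ := hP
  have hST : S.toReal = T.toReal :=
    (m.isAdjointOperator_iff.mp hS).trans (m.isAdjointOperator_iff.mp hT).symm
  refine (m.isPositive_toReal hPs hPp).eq_of_mul_self_eq (m.isPositive_toReal hT hpos) ?_
  nth_rw 1 [← hST]
  ext x
  exact DFunLike.congr_fun hPP x

theorem realTrace_mulConj [CompleteSpace H] {G : Type*} [Group G] [TopologicalSpace G]
    (U : G →* (H ≃ₗᵢ[R] H)) (hU : IsStronglyContinuous U) (A B : H →L[R] H)
    (hB : IsSelfAdjointOperator D B) (hBt : IsTraceClassOperator D B)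
    (hBp : IsPositiveOperator D B) :
    (∀ g : G, RealTraceWellDefined D (mulConj A B (U g))) ∧
      Continuous fun g : G => realTrace D (mulConj A B (U g)) := by
  obtain ⟨P, hP, N, hN, hs⟩ := hBt
  have hBpos := m.isPositive_toReal hB hBp
  have hPB := m.toReal_eq_of_isOperatorAbs hB hBp hP
  rw [m.summable_inner_apply_of_isPositive hN (hPB ▸ hBpos), hPB] at hs
  obtain ⟨K, hK, hKs, hKK⟩ := exists_isHilbertSchmidt_mul_self_eq hBpos hs
  let b := m.hilbertBasis hN
  let V : (H ≃ₗᵢ[R] H) → H →L[ℝ] H := fun W => (W.toContinuousLinearEquiv : H →L[R] H).toReal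
  have hT : ∀ W, (mulConj A B W).toReal = A.toReal * (V W * (K * K * V W.symm)) := by
    intro W
    rw [hKK]
    rfl
  have hT' : ∀ W, (mulConj A B W).toReal = (A.toReal * V W * K) * (K * V W.symm) := by
    intro W
    rw [hT]
    simp only [mul_assoc]
  have hX : ∀ W, IsHilbertSchmidt b (A.toReal * V W * K) := fun W => hK.mul_left _
  have hY : ∀ W : H ≃ₗᵢ[R] H, IsHilbertSchmidt b (K * V W.symm) := fun W => hK.mul_right _
  have hsum : ∀ W, ∀ M : Set H, IsHilbertBasisSet R D M →
      Summable fun u : M => inner D (u : H) (mulConj A B W u) := fun W M hM =>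
    m.summable_inner_apply (hX W) (hY W) (hT' W) hM
  -- The right side uses only the fixed basis `b`, whence independence of `M`.
  have htr : ∀ W, ∀ M : Set H, IsHilbertBasisSet R D M →
      RealPart.re (basisTrace D M (mulConj A B W)) =
        (∑' i, ⟪W (K (b i)), A.toReal (W (K (b i)))⟫) / Fintype.card κ := by
    intro W M hM
    refine m.re_basisTrace_eq hM (hsum W M hM) ?_
    rw [hT]
    exact hK.hasSum_inner_conj hKs _ _ _ W.adjoint_toReal _
  have hreal : ∀ W, realTrace D (mulConj A B W) =
      (∑' i, ⟪W (K (b i)), A.toReal (W (K (b i)))⟫) / Fintype.card κ := fun W =>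
    -- The chosen set is a Hilbert basis because `N` is one.
    htr W _ (Classical.epsilon_spec (p := fun N : Set H => IsHilbertBasisSet R D N) ⟨N, hN⟩)
  refine ⟨fun g => ⟨?_, fun M hM => ⟨hsum _ M hM, (htr _ M hM).trans (hreal _).symm⟩⟩, ?_⟩
  · obtain ⟨Q, hQ, hQp, hQQ⟩ := m.exists_isOperatorAbs (mulConj A B (U g))
    refine ⟨Q, hQ, N, hN, (m.summable_inner_apply_of_isPositive hN hQp).mpr ?_⟩
    rw [hT'] at hQQ
    exact (hX _).summable_inner_of_mul_self_eq (hY _) hQp hQQ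
  · simp only [hreal]
    exact (hK.continuous_tsum_inner A.toReal hU fun g => (U g).norm_map).div_const _

end RealCoordinates

end Realification

/-! ### Real coordinates for the three kinds of scalars. -/

section Scalars

open scoped RealInnerProductSpace

/-- The coordinates of a real scalar product. -/
noncomputable def RealCoordinates.ofRealScalars (𝕜 : Type*) [RCLike 𝕜]
    (hI : (RCLike.I : 𝕜) = 0) (H : Type*)
    [NormedAddCommGroup H] [InnerProductSpace 𝕜 H] :
    letI := InnerProductSpace.rclikeToReal 𝕜 H
    RealCoordinates 𝕜 𝕜 H Unit :=
  letI := InnerProductSpace.rclikeToReal 𝕜 H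
  have hz : ∀ z : 𝕜, ((RCLike.re z : ℝ) : 𝕜) = z := fun z => by
    nth_rw 2 [← RCLike.re_add_im z]
    rw [hI, mul_zero, add_zero]
  { coord := fun _ => RCLike.reCLM
    basis := fun _ => 1
    sum_coord_smul_basis := fun d => by simp [RCLike.real_smul_eq_coe_mul, hz]
    unit := fun _ => 1
    one := ()
    unit_one := rfl
    coord_one_algebraMap := fun r => by simp
    coord_algebraMap := fun r k h => (h rfl).elim
    re_eq_coord := fun d => rfl
    coord_inner := fun k x y => by simp [real_inner_eq_re_inner 𝕜]
    inner_unit_smul := fun k x y => by simp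
    inner_unit_smul_of_ne := fun k l x h => (h rfl).elim
    exists_smul_eq_sum := fun r => ⟨fun _ => RCLike.re r, fun x => by
      simp only [Finset.univ_unique, Finset.sum_singleton, one_smul]
      rw [RCLike.real_smul_eq_coe_smul (K := 𝕜), hz]⟩
    exists_adjoint_smul := fun r => ⟨starRingEnd 𝕜 r, fun x y => by
      simp [real_inner_eq_re_inner 𝕜, inner_smul_left, inner_smul_right]⟩ }

/-- The coordinates of a complex scalar product. -/
noncomputable def RealCoordinates.ofComplexScalars (𝕜 : Type*) [RCLike 𝕜]
    (hI : RCLike.im (RCLike.I : 𝕜) = 1) (H : Type*)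
    [NormedAddCommGroup H] [InnerProductSpace 𝕜 H] :
    letI := InnerProductSpace.rclikeToReal 𝕜 H
    RealCoordinates 𝕜 𝕜 H (Fin 2) :=
  letI := InnerProductSpace.rclikeToReal 𝕜 H
  have hII : (RCLike.I : 𝕜) * RCLike.I = -1 := RCLike.I_mul_I_of_nonzero fun h => by simp [h] at hI
  { coord := ![RCLike.reCLM, RCLike.imCLM]
    basis := ![1, RCLike.I]
    sum_coord_smul_basis := fun d => by
      simp [RCLike.real_smul_eq_coe_mul, RCLike.re_add_im]
    unit := ![1, RCLike.I]
    one := 0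
    unit_one := rfl
    coord_one_algebraMap := fun r => by simp
    coord_algebraMap := fun r k h => by
      fin_cases k
      · exact (h rfl).elim
      · simp
    re_eq_coord := fun d => rfl
    coord_inner := fun k x y => by
      fin_cases k
      · simp [real_inner_eq_re_inner 𝕜]
      · simp [real_inner_eq_re_inner 𝕜, inner_smul_left, hI]
    inner_unit_smul := fun k x y => by
      fin_cases k
      · simp
      · simp [real_inner_eq_re_inner 𝕜, inner_smul_left, inner_smul_right, ← mul_assoc, hII]
    inner_unit_smul_of_ne := fun k l x h => by
      fin_cases k <;> fin_cases l <;>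
        simp [real_inner_eq_re_inner 𝕜, inner_smul_left, inner_smul_right] at h ⊢
    exists_smul_eq_sum := fun r => ⟨![RCLike.re r, RCLike.im r], fun x => by
      simp only [Fin.sum_univ_two, Matrix.cons_val_zero, Matrix.cons_val_one, one_smul]
      rw [RCLike.real_smul_eq_coe_smul (K := 𝕜), RCLike.real_smul_eq_coe_smul (K := 𝕜), smul_smul,
        ← add_smul, RCLike.re_add_im]⟩
    exists_adjoint_smul := fun r => ⟨starRingEnd 𝕜 r, fun x y => by
      simp [real_inner_eq_re_inner 𝕜, inner_smul_left, inner_smul_right]⟩ }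

/-- The real coordinates of a quaternion. -/
noncomputable def Quaternion.coordCLM (k : Fin 4) : ℍ →L[ℝ] ℝ :=
  LinearMap.toContinuousLinearMap
    ((LinearMap.proj k).comp (QuaternionAlgebra.linearEquivTuple (-1 : ℝ) 0 (-1)).toLinearMap)

@[simp]
theorem Quaternion.coordCLM_apply (k : Fin 4) (q : ℍ) :
    coordCLM k q = ![q.re, q.imI, q.imJ, q.imK] k := by
  fin_cases k <;> rfl

/-- The basis `1, i, j, k` of the quaternions. -/
def Quaternion.standardBasis (k : Fin 4) : ℍ :=
  ⟨if k = 0 then 1 else 0, if k = 1 then 1 else 0, if k = 2 then 1 else 0, if k = 3 then 1 else 0⟩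

@[simp]
theorem Quaternion.re_standardBasis (k : Fin 4) :
    (standardBasis k).re = if k = 0 then 1 else 0 := rfl

@[simp]
theorem Quaternion.imI_standardBasis (k : Fin 4) :
    (standardBasis k).imI = if k = 1 then 1 else 0 := rfl

@[simp]
theorem Quaternion.imJ_standardBasis (k : Fin 4) :
    (standardBasis k).imJ = if k = 2 then 1 else 0 := rfl

@[simp]
theorem Quaternion.imK_standardBasis (k : Fin 4) :
    (standardBasis k).imK = if k = 3 then 1 else 0 := rfl

namespace QuaternionicInnerProductSpace

variable {H : Type*} [NormedAddCommGroup H] [Module ℍᵐᵒᵖ H] [QuaternionicInnerProductSpace H]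

theorem inner_add_left (x y z : H) : inner ℍ (x + y) z = inner ℍ x z + inner ℍ y z := by
  rw [← star_inner z, inner_add_right, star_add, star_inner, star_inner]

theorem inner_smul_left (x y : H) (q : ℍ) :
    inner ℍ (MulOpposite.op q • x) y = star q * inner ℍ x y := by
  rw [← star_inner y, inner_smul_right, star_mul, star_inner]

theorem norm_op_smul (q : ℍ) (x : H) : ‖MulOpposite.op q • x‖ = ‖q‖ * ‖x‖ := by
  have h := inner_self (MulOpposite.op q • x)
  rw [inner_smul_left, inner_smul_right, inner_self, Quaternion.coe_commutes, ← mul_assoc,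
    Quaternion.star_mul_self, ← Quaternion.coe_mul, Quaternion.coe_inj,
    Quaternion.normSq_eq_norm_mul_self] at h
  rw [← sq_eq_sq₀ (norm_nonneg _) (by positivity), ← h]
  ring

variable (H) in
/-- The underlying real Hilbert space of a quaternionic one. -/
@[reducible]
noncomputable def toReal : InnerProductSpace ℝ H :=
  { Module.compHom H ((algebraMap ℝ ℍᵐᵒᵖ : ℝ →+* ℍᵐᵒᵖ)) with
    norm_smul_le := fun r x => by
      change ‖MulOpposite.op (algebraMap ℝ ℍ r) • x‖ ≤ _
      rw [norm_op_smul, norm_algebraMap']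
    inner := fun x y => (inner ℍ x y).re
    norm_sq_eq_re_inner := fun x => by
      change _ = (inner ℍ x x).re
      rw [inner_self, Quaternion.re_coe]
    conj_inner_symm := fun x y => by
      change (inner ℍ y x).re = (inner ℍ x y).re
      rw [← star_inner x y, Quaternion.re_star]
    add_left := fun x y z => by
      change (inner ℍ (x + y) z).re = _
      rw [inner_add_left, Quaternion.re_add]
    smul_left := fun x y r => by
      change (inner ℍ (MulOpposite.op ((r : ℍ)) • x) y).re = r * (inner ℍ x y).re
      rw [inner_smul_left, Quaternion.star_coe, Quaternion.coe_mul_eq_smul, Quaternion.re_smul,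
        smul_eq_mul] }

theorem real_inner_eq (x y : H) :
    letI := toReal H
    ⟪x, y⟫ = (inner ℍ x y).re := rfl

theorem real_smul_eq (r : ℝ) (x : H) :
    letI := toReal H
    r • x = MulOpposite.op (r : ℍ) • x := rfl

variable (H) in
/-- The coordinates of a quaternionic scalar product. -/
noncomputable def realCoordinates :
    letI := toReal H
    RealCoordinates ℍᵐᵒᵖ ℍ H (Fin 4) :=
  letI := toReal H
  { coord := Quaternion.coordCLM
    basis := Quaternion.standardBasis
    sum_coord_smul_basis := fun d => by
      simp only [Fin.sum_univ_four]
      ext <;> simp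
    unit := fun k => MulOpposite.op (Quaternion.standardBasis k)
    one := 0
    unit_one := MulOpposite.unop_injective (by ext <;> simp)
    coord_one_algebraMap := fun r => rfl
    coord_algebraMap := fun r k h => by
      fin_cases k
      · exact (h rfl).elim
      · rfl
      · rfl
      · rfl
    re_eq_coord := fun d => rfl
    coord_inner := fun k x y => by
      rw [real_inner_eq, inner_smul_left]
      fin_cases k <;> simp
    inner_unit_smul := fun k x y => by
      rw [real_inner_eq, real_inner_eq, inner_smul_left, inner_smul_right]
      fin_cases k <;> simp
    inner_unit_smul_of_ne := fun k l x h => by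
      rw [real_inner_eq, inner_smul_left, inner_smul_right, inner_self]
      generalize ‖x‖ ^ 2 = s
      fin_cases k <;> fin_cases l <;> simp at h ⊢
    exists_smul_eq_sum := fun r => ⟨![r.unop.re, r.unop.imI, r.unop.imJ, r.unop.imK], fun x => by
      simp only [Fin.sum_univ_four, real_smul_eq, smul_smul, ← add_smul, ← MulOpposite.op_mul,
        ← MulOpposite.op_add]
      congr 1
      apply MulOpposite.unop_injective
      ext <;> simp⟩
    exists_adjoint_smul := fun r => ⟨MulOpposite.op (star r.unop), fun x y => by
      nth_rw 1 [real_inner_eq, real_inner_eq, ← MulOpposite.op_unop r]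
      rw [inner_smul_left, inner_smul_right]
      simp
      ring⟩ }

end QuaternionicInnerProductSpace

end Scalars

theorem proposition4p3 {G : Type*} [Group G] [TopologicalSpace G] [IsTopologicalGroup G] :
    -- real and complex Hilbert spaces
    (∀ (𝕜 : Type*) [RCLike 𝕜] (H : Type*) [NormedAddCommGroup H] [InnerProductSpace 𝕜 H]
        [CompleteSpace H] (U : G →* (H ≃ₗᵢ[𝕜] H)), IsStronglyContinuous U →
      (∀ A B : H →L[𝕜] H, IsSelfAdjointOperator 𝕜 B → IsTraceClassOperator 𝕜 B →
          IsPositiveOperator 𝕜 B →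
        (∀ g : G, RealTraceWellDefined 𝕜 (mulConj A B (U g))) ∧
          Continuous fun g : G => realTrace 𝕜 (mulConj A B (U g))) ∧
      (∀ P T : H →L[𝕜] H, IsOrthogonalProjector 𝕜 P → IsQuantumState 𝕜 T →
        (∀ g : G, RealTraceWellDefined 𝕜 (mulConj P T (U g))) ∧
          Continuous fun g : G => realTrace 𝕜 (mulConj P T (U g)))) ∧
    -- quaternionic Hilbert spaces
    (∀ (H : Type*) [NormedAddCommGroup H] [Module ℍᵐᵒᵖ H] [QuaternionicInnerProductSpace H]
        [CompleteSpace H] (U : G →* (H ≃ₗᵢ[ℍᵐᵒᵖ] H)), IsStronglyContinuous U →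
      (∀ A B : H →L[ℍᵐᵒᵖ] H, IsSelfAdjointOperator ℍ B → IsTraceClassOperator ℍ B →
          IsPositiveOperator ℍ B →
        (∀ g : G, RealTraceWellDefined ℍ (mulConj A B (U g))) ∧
          Continuous fun g : G => realTrace ℍ (mulConj A B (U g))) ∧
      (∀ P T : H →L[ℍᵐᵒᵖ] H, IsOrthogonalProjector ℍ P → IsQuantumState ℍ T →
        (∀ g : G, RealTraceWellDefined ℍ (mulConj P T (U g))) ∧
          Continuous fun g : G => realTrace ℍ (mulConj P T (U g)))) := by
  refine ⟨fun 𝕜 _ H _ _ _ U hU => ?_, fun H _ _ _ _ U hU => ?_⟩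
  · let := InnerProductSpace.rclikeToReal 𝕜 H
    have key : ∀ A B : H →L[𝕜] H, IsSelfAdjointOperator 𝕜 B → IsTraceClassOperator 𝕜 B →
        IsPositiveOperator 𝕜 B → (∀ g : G, RealTraceWellDefined 𝕜 (mulConj A B (U g))) ∧
          Continuous fun g : G => realTrace 𝕜 (mulConj A B (U g)) := by
      -- This separates real from complex scalars, that is, one coordinate from two.
      rcases RCLike.I_eq_zero_or_im_I_eq_one (K := 𝕜) with hI | hI
      · exact (RealCoordinates.ofRealScalars 𝕜 hI H).realTrace_mulConj U hU
      · exact (RealCoordinates.ofComplexScalars 𝕜 hI H).realTrace_mulConj U hU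
    exact ⟨key, fun P T _ hT => key P T hT.1 hT.2.2.1 hT.2.1⟩
  · let := QuaternionicInnerProductSpace.toReal H
    have key := (QuaternionicInnerProductSpace.realCoordinates H).realTrace_mulConj U hU
    exact ⟨key, fun P T _ hT => key P T hT.1 hT.2.2.1 hT.2.1⟩
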